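/- Theorem 2.3. Let $n=2^k$ with $k\in\{0,1,2,\dots\}$, let $f:(0,\infty)\to\mathbb C$, and let $a\in\mathbb R$. Write $$\mathcal L_n\{f;p\}=\int_0^\infty x^{n-1}e^{-x^np^n}f(x)\,dx ,\qquad\text{so that}\qquad \mathcal L_n\{f;y^{1/n}\}=\int_0^\infty x^{n-1}e^{-x^ny}f(x)\,dx .$$ Suppose that the integral $\mathcal L_n\{f;y^{1/n}\}$ converges absolutely for all $y$ with $\operatorname{Re}y\ge a$, and that the function $y\mapsto\mathcal L_n\{f;y^{1/n}\}$ on this half-plane extends to a single-valued analytic function $F$ on $\mathbb C\setminus\{y_1,\dots,y_m\}$, where $y_1,\dots,y_m$ are finitely many distinct points with $\operatorname{Re}y_j<a$ (isolated singularities of any kind; in particular $y=0$ is not a branch point). Suppose also that $F(y)\to0$ as $|y|\to\infty$ within the half-plane $\operatorname{Re}y\le a$. Then for every $x>0$ the limit $$\frac1{2\pi i}\int_{a-i\infty}^{a+i\infty}nF(y)e^{yx^n}\,dy:=\lim_{R\to\infty}\frac1{2\pi i}\int_{a-iR}^{a+iR}nF(y)e^{yx^n}\,dy$$ exists and $$\frac1{2\pi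 i}\int_{a-i\infty}^{a+i\infty}nF(y)e^{yx^n}\,dy=\sum_{j=1}^m\operatorname{Res}\bigl(nF(y)e^{yx^n};\,y=y_j\bigr).$$ Moreover this common value equals $f(x)$ for almost every $x>0$, and for every $x>0$ at which $f$ is continuous. -/

import Mathlib

open Filter Topology MeasureTheory Set

noncomputable section

/-- The integrand `x ^ (n - 1) * exp (-x ^ n * p ^ n) * f x` of the generalized Laplace transform
of order `n`, at the complex parameter `p`. -/
def LnIntegrand (n : ℕ) (f : ℝ → ℂ) (p : ℂ) (x : ℝ) : ℂ :=
  (x : ℂ) ^ (n - 1) * Complex.exp (-(x : ℂ) ^ n * p ^ n) * f x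

/-- The integral defining the transform of order `n` of `f` exists at the parameter `p`. -/
def LnConvergent (n : ℕ) (f : ℝ → ℂ) (p : ℂ) : Prop :=
  IntegrableOn (LnIntegrand n f p) (Ioi 0)

/-- The transform `ℒ_n{f(x); p} = ∫₀^∞ x ^ (n - 1) * exp (-x ^ n * p ^ n) * f x dx`. -/
def Ln (n : ℕ) (f : ℝ → ℂ) (p : ℂ) : ℂ :=
  ∫ x in Ioi (0 : ℝ), LnIntegrand n f p x

/-- The residue of `g` at an isolated singularity `z` of any kind (removable, pole or essential):
`(1 / (2 π i)) ∮ g` over the circles of radius `r` around `z`. For an isolated singularity the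
integral does not depend on `r` once `r > 0` is small, so that the limit `r → 0+` is this common
value. -/
def residue (g : ℂ → ℂ) (z : ℂ) : ℂ :=
  limUnder (𝓝[>] (0 : ℝ)) fun r : ℝ =>
    (2 * (Real.pi : ℂ) * Complex.I)⁻¹ * ∮ w in C(z, r), g w

/-- `(1 / (2 π i)) ∫ g(y) dy` over the vertical segment from `a - i R` to `a + i R`,
parametrized by `y = a + i t`, `dy = i dt`. -/
def verticalSegmentIntegral (g : ℂ → ℂ) (a R : ℝ) : ℂ :=
  (2 * (Real.pi : ℂ) * Complex.I)⁻¹ *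
    ∫ t in (-R)..R, g ((a : ℂ) + (t : ℂ) * Complex.I) * Complex.I

/-- `(1 / (2 π i)) ∫_{a - i ∞}^{a + i ∞} g(y) dy` converges to `v`, as the limit of the integrals
over the segments from `a - i R` to `a + i R`. -/
def HasVerticalLineIntegral (g : ℂ → ℂ) (a : ℝ) (v : ℂ) : Prop :=
  Tendsto (fun R : ℝ => verticalSegmentIntegral g a R) atTop (𝓝 v)

/-- The integrand `n F(y) exp (y x ^ n)` of the complex inversion formula. -/
def inversionIntegrand (n : ℕ) (F : ℂ → ℂ) (x : ℝ) (y : ℂ) : ℂ :=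
  (n : ℂ) * F y * Complex.exp (y * (x : ℂ) ^ n)

end

/-!
Since `(y ^ (1 / n)) ^ n = y`, the substitution `u = x ^ n` turns `n * F y` into the
ordinary Laplace transform of `u ↦ f (u ^ (1 / n))`, and on the line `Re y = a` this is the Fourier
transform of the integrable function `G u = exp (-a u) * f (u ^ (1 / n))` on `(0, ∞)`
(`fourier_dampedRoot`).

*The contour side.* The segment from `a - i R` to `a + i R` is closed by the other three sides of the
rectangle `[a - R, a] × [-R, R]`, which contains all singularities for large `R`. By the residue
theorem (`rectIntegral_eq_sum_residue`) the contour integral is the sum of the residues, and as `F`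
tends to `0` in the left half-plane the three other sides contribute an error that tends to `0`,
locally uniformly in `u > 0` (`tendstoLocallyUniformlyOn_verticalSegmentIntegral`). The singularities
may be essential, so the residue theorem is proved by splitting off principal parts, written as
Cauchy integrals over small circles (`exists_split_principal_part`), one singularity after the other;
the boundary integral of a principal part is computed by Fubini from the winding number of a
rectangle (`rectIntegral_sub_inv`, `rectIntegral_cauchy`).

*The function side.* The sum of residues is thus a locally uniform limit of truncated Fourier
inversion integrals of `G`. Against a smooth compactly supported function these integrals also
converge to the pairing with `G` itself, by self-adjointness of the Fourier transform and the
inversion theorem for Schwartz functions. So the two limits agree almost everywhere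
(`ae_eq_of_tendstoLocallyUniformlyOn_fourierPartialInv`). The locally uniform limit is continuous,
hence they agree at every point of continuity of `f` as well.
-/

open FourierTransform

noncomputable section

/-! ### Cauchy integrals over circles -/

open Complex Metric in
/-- The Cauchy integral over a circle is holomorphic off that circle. -/
theorem differentiableAt_circleIntegral_cauchy {g : ℂ → ℂ} {c z : ℂ} {r : ℝ}
    (hg : ContinuousOn g (sphere c r)) (hr : 0 ≤ r) (hz : z ∉ sphere c r) :
    DifferentiableAt ℂ (fun z => ∮ w in C(c, r), (w - z)⁻¹ • g w) z := by
  obtain ⟨δ, hδ, hδz⟩ : ∃ δ > 0, ∀ w ∈ sphere c r, 2 * δ ≤ dist w z := by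
    obtain ⟨δ, hδ, h⟩ := Metric.isOpen_iff.1 (isClosed_sphere (x := c) (ε := r)).isOpen_compl z hz
    refine ⟨δ / 2, by positivity, fun w hw => ?_⟩
    by_contra! hlt
    exact h (show w ∈ ball z δ by rw [mem_ball]; linarith) hw
  have hsph : ∀ θ, circleMap c r θ ∈ sphere c r := fun θ => circleMap_mem_sphere c hr θ
  have hne : ∀ θ, ∀ x ∈ ball z δ, δ ≤ ‖circleMap c r θ - x‖ := by
    intro θ x hx
    have h1 := hδz _ (hsph θ)
    have h2 := dist_triangle (circleMap c r θ) x z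
    rw [mem_ball] at hx
    rw [← dist_eq_norm]
    linarith
  have hgc : Continuous fun θ => g (circleMap c r θ) :=
    hg.comp_continuous (continuous_circleMap c r) hsph
  obtain ⟨M, hM⟩ := (isCompact_sphere c r).exists_bound_of_continuousOn hg
  have hcont : ∀ x ∈ ball z δ, Continuous fun θ =>
      deriv (circleMap c r) θ • (circleMap c r θ - x)⁻¹ • g (circleMap c r θ) := by
    intro x hx
    have h0 : ∀ θ, circleMap c r θ - x ≠ 0 := fun θ =>
      norm_pos_iff.1 (hδ.trans_le (hne θ x hx))
    simp only [deriv_circleMap]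
    exact (by fun_prop : Continuous fun θ => circleMap 0 r θ * I).smul
      ((((continuous_circleMap c r).sub continuous_const).inv₀ h0).smul hgc)
  have hzb : z ∈ ball z δ := mem_ball_self hδ
  refine (intervalIntegral.hasDerivAt_integral_of_dominated_loc_of_deriv_le
    (F := fun x θ => deriv (circleMap c r) θ • (circleMap c r θ - x)⁻¹ • g (circleMap c r θ))
    (F' := fun x θ =>
      deriv (circleMap c r) θ • (((circleMap c r θ - x) ^ 2)⁻¹ • g (circleMap c r θ)))
    (bound := fun _ => r * ((δ ^ 2)⁻¹ * M)) (ball_mem_nhds z hδ) ?_ ?_ ?_ ?_ ?_ ?_).2.differentiableAt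
  · filter_upwards [ball_mem_nhds z hδ] with x hx
    exact (hcont x hx).aestronglyMeasurable
  · exact (hcont z hzb).intervalIntegrable _ _
  · have h0 : ∀ θ, (circleMap c r θ - z) ^ 2 ≠ 0 := fun θ =>
      pow_ne_zero _ (norm_pos_iff.1 (hδ.trans_le (hne θ z hzb)))
    simp only [deriv_circleMap]
    exact ((by fun_prop : Continuous fun θ => circleMap 0 r θ * I).smul
      (((((continuous_circleMap c r).sub continuous_const).pow 2).inv₀ h0).smul
        hgc)).aestronglyMeasurable
  · refine Eventually.of_forall fun θ _ x hx => ?_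
    have h1 := hne θ x hx
    rw [norm_smul, norm_smul, deriv_circleMap, norm_mul, norm_I, mul_one, norm_circleMap_zero,
      abs_of_nonneg hr, norm_inv, norm_pow]
    have h2 := hM _ (hsph θ)
    gcongr
  · exact intervalIntegrable_const
  · refine Eventually.of_forall fun θ _ x hx => ?_
    have h0 : circleMap c r θ - x ≠ 0 := norm_pos_iff.1 (hδ.trans_le (hne θ x hx))
    have h1 : HasDerivAt (fun x => (circleMap c r θ - x)⁻¹) ((circleMap c r θ - x) ^ 2)⁻¹ x := by
      have := ((hasDerivAt_id x).const_sub (circleMap c r θ)).inv h0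
      simpa [neg_div, div_eq_mul_inv] using! this
    exact (h1.smul_const (g (circleMap c r θ))).const_smul (deriv (circleMap c r) θ)

open Complex Metric in
/-- **Cauchy's formula on an annulus**: a function holomorphic on an annulus is the difference of
its Cauchy integrals over the outer and the inner circle. -/
theorem cauchy_annulus {g : ℂ → ℂ} {c z : ℂ} {r R : ℝ} (hr : 0 < r)
    (hd : ∀ w, r ≤ ‖w - c‖ → ‖w - c‖ ≤ R → DifferentiableAt ℂ g w)
    (hz : r < ‖z - c‖) (hz' : ‖z - c‖ < R) :
    (∮ w in C(c, R), (w - z)⁻¹ • g w) - (∮ w in C(c, r), (w - z)⁻¹ • g w)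
      = 2 * Real.pi * I * g z := by
  have hrR : r < R := hz.trans hz'
  have hzd := hd z hz.le hz'.le
  -- `dslope g z` is continuous at `z`, so its integrals over the two circles agree.
  have key : (∮ w in C(c, R), dslope g z w) = ∮ w in C(c, r), dslope g z w := by
    have hmem : ∀ w ∈ closedBall c R \ ball c r, r ≤ ‖w - c‖ ∧ ‖w - c‖ ≤ R := by
      intro w hw
      simpa [mem_closedBall, mem_ball, dist_eq_norm, and_comm] using hw
    refine circleIntegral_eq_of_differentiable_on_annulus_off_countable hr hrR.le
      (countable_singleton z) ?_ ?_
    · intro w hw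
      have hw' := hd w (hmem w hw).1 (hmem w hw).2
      by_cases h : w = z
      · subst h
        exact (continuousAt_dslope_same.2 hw').continuousWithinAt
      · exact ((continuousAt_dslope_of_ne h).2 hw'.continuousAt).continuousWithinAt
    · intro w hw
      have h1 := hmem w ⟨ball_subset_closedBall hw.1.1, fun h => hw.1.2 (ball_subset_closedBall h)⟩
      exact (differentiableAt_dslope_of_ne hw.2).2 (hd w h1.1 h1.2)
  have hcirc : ∀ ρ, 0 < ρ → r ≤ ρ → ρ ≤ R → ρ ≠ ‖z - c‖ →
      (∮ w in C(c, ρ), dslope g z w) =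
        (∮ w in C(c, ρ), (w - z)⁻¹ • g w) - (∮ w in C(c, ρ), (w - z)⁻¹) * g z := by
    intro ρ hρ h1 h2 h3
    have hne : ∀ w ∈ sphere c ρ, w ≠ z := by
      rintro w hw rfl
      rw [mem_sphere, dist_eq_norm] at hw
      exact h3 hw.symm
    have hgc : ContinuousOn g (sphere c ρ) := fun w hw => by
      rw [mem_sphere, dist_eq_norm] at hw
      exact (hd w (by linarith) (by linarith)).continuousAt.continuousWithinAt
    have hic : ContinuousOn (fun w : ℂ => (w - z)⁻¹) (sphere c ρ) :=
      (continuousOn_id.sub continuousOn_const).inv₀ fun w hw => sub_ne_zero.2 (hne w hw)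
    rw [show (∮ w in C(c, ρ), (w - z)⁻¹) * g z = ∮ w in C(c, ρ), (w - z)⁻¹ • g z by
      rw [circleIntegral.integral_smul_const, smul_eq_mul],
      ← circleIntegral.integral_sub]
    · refine circleIntegral.integral_congr hρ.le fun w hw => ?_
      rw [dslope_of_ne _ (hne w hw), slope_def_module, smul_sub]
    · exact (hic.smul hgc).circleIntegrable hρ.le
    · exact (hic.smul continuousOn_const).circleIntegrable hρ.le
  rw [hcirc R (hr.trans hrR) hrR.le le_rfl hz'.ne', hcirc r hr le_rfl hrR.le hz.ne,
    circleIntegral.integral_sub_inv_of_mem_ball (by rwa [mem_ball, dist_eq_norm])] at key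
  have h0 : (∮ w in C(c, r), (w - z)⁻¹) = 0 := by
    have hne : ∀ w ∈ closedBall c r, w - z ≠ 0 := by
      intro w hw h
      rw [sub_eq_zero.1 h, mem_closedBall, dist_eq_norm] at hw
      linarith
    refine circleIntegral_eq_zero_of_differentiable_on_off_countable hr.le countable_empty ?_ ?_
    · exact (continuousOn_id.sub continuousOn_const).inv₀ hne
    · intro w hw
      exact (differentiableAt_id.sub_const z).inv (hne w (ball_subset_closedBall hw.1))
  rw [h0] at key
  linear_combination key

/-- The integral of `f` along the boundary of the rectangle with corners `z` and `w`, run through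
counterclockwise when `z` is the lower left corner. -/
def rectIntegral (f : ℂ → ℂ) (z w : ℂ) : ℂ :=
  (∫ x : ℝ in z.re..w.re, f (x + z.im * Complex.I)) -
    (∫ x : ℝ in z.re..w.re, f (x + w.im * Complex.I)) +
    Complex.I • (∫ y : ℝ in z.im..w.im, f (w.re + y * Complex.I)) -
    Complex.I • ∫ y : ℝ in z.im..w.im, f (z.re + y * Complex.I)

/-! ### Integrals along the boundary of a rectangle -/

/-- The boundary of the rectangle with lower left corner `z` and upper right corner `w`. -/
def rectBoundary (z w : ℂ) : Set ℂ :=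
  (Icc z.re w.re ×ℂ Icc z.im w.im) \ (Ioo z.re w.re ×ℂ Ioo z.im w.im)

section boundary

variable {z w : ℂ}

theorem bottom_mem_rectBoundary (him : z.im ≤ w.im) {x : ℝ} (hx : x ∈ Icc z.re w.re) :
    (x + z.im * Complex.I : ℂ) ∈ rectBoundary z w := by
  simp only [rectBoundary, Set.mem_sdiff, Complex.mem_reProdIm, mem_Icc, mem_Ioo] at *
  simp; grind

theorem top_mem_rectBoundary (him : z.im ≤ w.im) {x : ℝ} (hx : x ∈ Icc z.re w.re) :
    (x + w.im * Complex.I : ℂ) ∈ rectBoundary z w := by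
  simp only [rectBoundary, Set.mem_sdiff, Complex.mem_reProdIm, mem_Icc, mem_Ioo] at *
  simp; grind

theorem left_mem_rectBoundary (hre : z.re ≤ w.re) {y : ℝ} (hy : y ∈ Icc z.im w.im) :
    (z.re + y * Complex.I : ℂ) ∈ rectBoundary z w := by
  simp only [rectBoundary, Set.mem_sdiff, Complex.mem_reProdIm, mem_Icc, mem_Ioo] at *
  simp; grind

theorem right_mem_rectBoundary (hre : z.re ≤ w.re) {y : ℝ} (hy : y ∈ Icc z.im w.im) :
    (w.re + y * Complex.I : ℂ) ∈ rectBoundary z w := by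
  simp only [rectBoundary, Set.mem_sdiff, Complex.mem_reProdIm, mem_Icc, mem_Ioo] at *
  simp; grind

theorem rectIntegral_congr {f g : ℂ → ℂ} (hre : z.re ≤ w.re) (him : z.im ≤ w.im)
    (h : EqOn f g (rectBoundary z w)) : rectIntegral f z w = rectIntegral g z w := by
  unfold rectIntegral
  congr 1
  · congr 1
    · congr 1 <;> refine intervalIntegral.integral_congr fun x hx => ?_ <;>
        rw [uIcc_of_le hre] at hx
      · exact h (bottom_mem_rectBoundary him hx)
      · exact h (top_mem_rectBoundary him hx)
    · congr 1
      refine intervalIntegral.integral_congr fun x hx => ?_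
      rw [uIcc_of_le him] at hx
      exact h (right_mem_rectBoundary hre hx)
  · congr 1
    refine intervalIntegral.integral_congr fun x hx => ?_
    rw [uIcc_of_le him] at hx
    exact h (left_mem_rectBoundary hre hx)

theorem rectIntegral_sub {f g : ℂ → ℂ} (hre : z.re ≤ w.re) (him : z.im ≤ w.im)
    (hf : ContinuousOn f (rectBoundary z w)) (hg : ContinuousOn g (rectBoundary z w)) :
    rectIntegral (fun ζ => f ζ - g ζ) z w = rectIntegral f z w - rectIntegral g z w := by
  have hh : ∀ {F : ℂ → ℂ}, ContinuousOn F (rectBoundary z w) → ∀ {γ : ℝ → ℂ}, Continuous γ →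
      ∀ {a b : ℝ}, a ≤ b → (∀ x ∈ Icc a b, γ x ∈ rectBoundary z w) →
        IntervalIntegrable (fun x => F (γ x)) volume a b := by
    intro F hF γ hγ a b hab hm
    refine ContinuousOn.intervalIntegrable ?_
    rw [uIcc_of_le hab]
    exact hF.comp hγ.continuousOn hm
  unfold rectIntegral
  rw [intervalIntegral.integral_sub, intervalIntegral.integral_sub, intervalIntegral.integral_sub,
    intervalIntegral.integral_sub]
  · simp only [smul_eq_mul]; ring
  · exact hh hf (by fun_prop) him fun x hx => left_mem_rectBoundary hre hx
  · exact hh hg (by fun_prop) him fun x hx => left_mem_rectBoundary hre hx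
  · exact hh hf (by fun_prop) him fun x hx => right_mem_rectBoundary hre hx
  · exact hh hg (by fun_prop) him fun x hx => right_mem_rectBoundary hre hx
  · exact hh hf (by fun_prop) hre fun x hx => top_mem_rectBoundary him hx
  · exact hh hg (by fun_prop) hre fun x hx => top_mem_rectBoundary him hx
  · exact hh hf (by fun_prop) hre fun x hx => bottom_mem_rectBoundary him hx
  · exact hh hg (by fun_prop) hre fun x hx => bottom_mem_rectBoundary him hx

end boundary

/-- The logarithm as a primitive of `ζ ↦ (ζ - p)⁻¹` along a segment in a slit plane. -/
theorem integral_inv_segment_eq_log {p u v : ℂ} {a b : ℝ}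
    (h : ∀ x ∈ uIcc a b, u + x * v - p ∈ Complex.slitPlane) :
    v * ∫ x : ℝ in a..b, (u + x * v - p)⁻¹ =
      Complex.log (u + b * v - p) - Complex.log (u + a * v - p) := by
  rw [← intervalIntegral.integral_const_mul]
  refine intervalIntegral.integral_eq_sub_of_hasDerivAt
    (f := fun x : ℝ => Complex.log (u + x * v - p)) (fun x hx => ?_) ?_
  · have h1 : HasDerivAt (fun x : ℝ => u + x * v - p) v x := by
      simpa using (((Complex.ofRealCLM.hasDerivAt (x := x)).mul_const v).const_add u).sub_const p
    simpa [div_eq_mul_inv] using h1.clog_real (h x hx)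
  · refine ContinuousOn.intervalIntegrable ?_
    refine continuousOn_const.mul (ContinuousOn.inv₀ (by fun_prop) fun x hx => ?_)
    exact Complex.slitPlane_ne_zero (h x hx)

theorem log_sub_log_neg_of_im_pos {ζ : ℂ} (h : 0 < ζ.im) :
    Complex.log ζ - Complex.log (-ζ) = Real.pi * Complex.I := by
  simp only [Complex.log, norm_neg, Complex.arg_neg_eq_arg_sub_pi_of_im_pos h]
  push_cast; ring

theorem log_sub_log_neg_of_im_neg {ζ : ℂ} (h : ζ.im < 0) :
    Complex.log ζ - Complex.log (-ζ) = -(Real.pi * Complex.I) := by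
  simp only [Complex.log, norm_neg, Complex.arg_neg_eq_arg_add_pi_of_im_neg h]
  push_cast; ring

open Complex in
/-- The winding number of the boundary of a rectangle around an interior point is `1`. -/
theorem rectIntegral_sub_inv {z w p : ℂ} (hp : p ∈ Ioo z.re w.re ×ℂ Ioo z.im w.im) :
    rectIntegral (fun ζ => (ζ - p)⁻¹) z w = 2 * Real.pi * I := by
  obtain ⟨⟨h1, h2⟩, h3, h4⟩ := hp
  have hb := integral_inv_segment_eq_log (p := p) (u := z.im * I) (v := 1) (a := z.re) (b := w.re)
    fun x _ => Or.inr (by simp; linarith)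
  have ht := integral_inv_segment_eq_log (p := p) (u := w.im * I) (v := 1) (a := z.re) (b := w.re)
    fun x _ => Or.inr (by simp; linarith)
  have hr := integral_inv_segment_eq_log (p := p) (u := w.re) (v := I) (a := z.im) (b := w.im)
    fun x _ => Or.inl (by simp; linarith)
  -- On the left edge the branch cut is avoided by taking the logarithm of the negative.
  have hl := integral_inv_segment_eq_log (p := -p) (u := -z.re) (v := -I) (a := z.im) (b := w.im)
    fun x _ => Or.inl (by simp; linarith)
  have hl' : ∀ y : ℝ, -(z.re : ℂ) + y * -I - -p = -(z.re + y * I - p) := fun y => by ring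
  simp only [hl', inv_neg, intervalIntegral.integral_neg] at hl
  have h5 := log_sub_log_neg_of_im_pos (ζ := z.re + w.im * I - p) (by simp; linarith)
  have h6 := log_sub_log_neg_of_im_neg (ζ := z.re + z.im * I - p) (by simp; linarith)
  simp only [mul_one, add_comm (_ * I : ℂ), one_mul] at hb ht
  simp only [rectIntegral, smul_eq_mul, hb, ht, hr]
  linear_combination -hl + h5 - h6

open Complex Metric in
/-- Fubini for the integral along a path of a Cauchy integral over a circle that the path avoids. -/
theorem integral_circleIntegral_cauchy {g : ℂ → ℂ} {c : ℂ} {r a b : ℝ} {γ : ℝ → ℂ} (hr : 0 ≤ r)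
    (hg : ContinuousOn g (sphere c r)) (hγ : Continuous γ) (hab : a ≤ b)
    (hm : ∀ x ∈ Icc a b, γ x ∉ sphere c r) :
    IntervalIntegrable (fun θ : ℝ => deriv (circleMap c r) θ •
        ((∫ x in a..b, (γ x - circleMap c r θ)⁻¹) • g (circleMap c r θ))) volume 0 (2 * Real.pi) ∧
    ∫ x in a..b, (∮ w in C(c, r), (w - γ x)⁻¹ • g w) =
      -∫ θ in 0..2 * Real.pi, deriv (circleMap c r) θ •
        ((∫ x in a..b, (γ x - circleMap c r θ)⁻¹) • g (circleMap c r θ)) := by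
  have hsph : ∀ θ, circleMap c r θ ∈ sphere c r := fun θ => circleMap_mem_sphere c hr θ
  have hpi : (0 : ℝ) ≤ 2 * Real.pi := by positivity
  let K : ℝ → ℝ → ℂ := fun x θ =>
    deriv (circleMap c r) θ • ((γ x - circleMap c r θ)⁻¹ • g (circleMap c r θ))
  have hKc : ContinuousOn (Function.uncurry K) (Icc a b ×ˢ Icc 0 (2 * Real.pi)) := by
    have hgc : Continuous fun θ => g (circleMap c r θ) :=
      hg.comp_continuous (continuous_circleMap c r) hsph
    simp only [Function.uncurry_def, K, deriv_circleMap]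
    have hdc : Continuous fun p : ℝ × ℝ => circleMap 0 r p.2 * I := by fun_prop
    have hinv : ContinuousOn (fun p : ℝ × ℝ => (γ p.1 - circleMap c r p.2)⁻¹)
        (Icc a b ×ˢ Icc 0 (2 * Real.pi)) := by
      refine ContinuousOn.inv₀ ?_ ?_
      · exact ((hγ.comp continuous_fst).sub
          ((continuous_circleMap c r).comp continuous_snd)).continuousOn
      · rintro ⟨x, θ⟩ ⟨hx, -⟩ h0
        exact hm x hx (by rw [sub_eq_zero.1 h0]; exact hsph θ)
    exact hdc.continuousOn.smul (hinv.smul (hgc.comp continuous_snd).continuousOn)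
  have hK : Integrable (Function.uncurry K)
      ((volume.restrict (Ioc a b)).prod (volume.restrict (Ioc 0 (2 * Real.pi)))) := by
    rw [Measure.prod_restrict]
    exact (hKc.integrableOn_compact (isCompact_Icc.prod isCompact_Icc)).mono_set
      (prod_mono Ioc_subset_Icc_self Ioc_subset_Icc_self)
  have hswap : ∀ θ, ∫ x in Ioc a b, K x θ = deriv (circleMap c r) θ •
      ((∫ x in a..b, (γ x - circleMap c r θ)⁻¹) • g (circleMap c r θ)) := by
    intro θ
    rw [intervalIntegral.integral_of_le hab]
    simp only [K]
    rw [integral_smul, integral_smul_const]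
  constructor
  · rw [intervalIntegrable_iff_integrableOn_Ioc_of_le hpi]
    refine hK.integral_prod_right.congr (Eventually.of_forall fun θ => ?_)
    exact hswap θ
  · have h1 : ∀ x, (∮ w in C(c, r), (w - γ x)⁻¹ • g w) =
        -∫ θ in Ioc 0 (2 * Real.pi), K x θ := by
      intro x
      rw [circleIntegral, intervalIntegral.integral_of_le hpi, ← integral_neg]
      refine integral_congr_ae (Eventually.of_forall fun θ => ?_)
      simp only [K, ← neg_sub (γ x), inv_neg, neg_smul, smul_neg]
    simp only [h1]
    rw [intervalIntegral.integral_neg, intervalIntegral.integral_of_le hab,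
      integral_integral_swap hK, intervalIntegral.integral_of_le hpi]
    simp only [hswap]

open Complex Metric in
/-- The boundary integral of the Cauchy integral over a circle inside the rectangle. After division
by `-(2πi)` this says that a principal part has the same boundary integral as the function it is
split off from has circle integral. -/
theorem rectIntegral_cauchy {g : ℂ → ℂ} {c z w : ℂ} {r : ℝ} (hr : 0 ≤ r)
    (hg : ContinuousOn g (sphere c r)) (hre : z.re ≤ w.re) (him : z.im ≤ w.im)
    (hsub : sphere c r ⊆ Ioo z.re w.re ×ℂ Ioo z.im w.im) :
    rectIntegral (fun ζ => ∮ w in C(c, r), (w - ζ)⁻¹ • g w) z w =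
      -(2 * Real.pi * I * ∮ w in C(c, r), g w) := by
  have hnot : ∀ {ζ}, ζ ∈ rectBoundary z w → ζ ∉ sphere c r := fun h1 h2 => h1.2 (hsub h2)
  have hsph : ∀ θ, circleMap c r θ ∈ sphere c r := fun θ => circleMap_mem_sphere c hr θ
  obtain ⟨b1, b2⟩ := integral_circleIntegral_cauchy (γ := fun x : ℝ => x + z.im * I) hr hg
    (by fun_prop) hre fun x hx => hnot (bottom_mem_rectBoundary him hx)
  obtain ⟨t1, t2⟩ := integral_circleIntegral_cauchy (γ := fun x : ℝ => x + w.im * I) hr hg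
    (by fun_prop) hre fun x hx => hnot (top_mem_rectBoundary him hx)
  obtain ⟨r1, r2⟩ := integral_circleIntegral_cauchy (γ := fun y : ℝ => w.re + y * I) hr hg
    (by fun_prop) him fun x hx => hnot (right_mem_rectBoundary hre hx)
  obtain ⟨l1, l2⟩ := integral_circleIntegral_cauchy (γ := fun y : ℝ => z.re + y * I) hr hg
    (by fun_prop) him fun x hx => hnot (left_mem_rectBoundary hre hx)
  simp only [rectIntegral, b2, t2, r2, l2]
  have hsplit : (2 * Real.pi * I * ∮ w in C(c, r), g w) = ∫ θ in 0..2 * Real.pi,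
      deriv (circleMap c r) θ • (rectIntegral (fun ζ => (ζ - circleMap c r θ)⁻¹) z w •
        g (circleMap c r θ)) := by
    rw [circleIntegral, ← intervalIntegral.integral_const_mul]
    refine intervalIntegral.integral_congr fun θ _ => ?_
    simp only [rectIntegral_sub_inv (hsub (hsph θ)), smul_eq_mul]
    ring
  have hlin := intervalIntegral.integral_sub ((b1.sub t1).add (r1.const_mul I)) (l1.const_mul I)
  rw [intervalIntegral.integral_add (b1.sub t1) (r1.const_mul I),
    intervalIntegral.integral_sub b1 t1, intervalIntegral.integral_const_mul,
    intervalIntegral.integral_const_mul] at hlin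
  rw [hsplit]
  simp only [smul_eq_mul] at hlin ⊢
  have hcongr : ∀ {u v : ℝ → ℂ}, (∀ θ, u θ = v θ) →
      ∫ θ in 0..2 * Real.pi, u θ = ∫ θ in 0..2 * Real.pi, v θ :=
    fun h => intervalIntegral.integral_congr fun θ _ => h θ
  refine Eq.trans ?_ (neg_inj.2 (hlin.symm.trans (hcongr fun θ => ?_)))
  · ring
  · simp only [rectIntegral, smul_eq_mul]
    ring

/-! ### The residue theorem for a rectangle -/

open Complex Metric in
/-- Circle integrals around an isolated singularity do not depend on the small radius. -/
theorem circleIntegral_eventually_eq {g : ℂ → ℂ} {c : ℂ} {R : ℝ} (hR : 0 < R)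
    (hg : ∀ z, z ≠ c → ‖z - c‖ ≤ R → DifferentiableAt ℂ g z) :
    ∀ᶠ r in 𝓝[>] (0 : ℝ), (∮ w in C(c, r), g w) = ∮ w in C(c, R), g w := by
  filter_upwards [Ioo_mem_nhdsGT hR] with r hr
  have hd : ∀ w, w ∈ closedBall c R \ ball c r → DifferentiableAt ℂ g w := by
    intro w hw
    simp only [Set.mem_sdiff, mem_closedBall, mem_ball, dist_eq_norm, not_lt] at hw
    refine hg w ?_ hw.1
    rintro rfl
    simp at hw
    linarith [hr.1]
  exact (circleIntegral_eq_of_differentiable_on_annulus_off_countable hr.1 hr.2.le countable_empty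
    (fun w hw => (hd w hw).continuousAt.continuousWithinAt)
    fun w hw => hd w ⟨ball_subset_closedBall hw.1.1,
      fun h => hw.1.2 (ball_subset_closedBall h)⟩).symm

open Complex Metric in
/-- Splitting off the principal part at one isolated singularity `c`: outside a small disc `g` is
the sum of `g₁`, which is holomorphic at `c` and wherever `g` is, and of its principal part
`-(2πi)⁻¹ ∮ g w / (w - z) dw`. -/
theorem exists_split_principal_part {g : ℂ → ℂ} {c : ℂ} {ρ R : ℝ} (hρ : 0 < ρ) (hρR : ρ < R)
    (hg : ∀ z, z ≠ c → ‖z - c‖ ≤ R → DifferentiableAt ℂ g z) :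
    ∃ g₁ : ℂ → ℂ, (∀ z, (z = c ∨ DifferentiableAt ℂ g z) → DifferentiableAt ℂ g₁ z) ∧
      ∀ z, ρ < ‖z - c‖ →
        g₁ z = g z - -((2 * Real.pi * I)⁻¹ * ∮ w in C(c, ρ), (w - z)⁻¹ • g w) := by
  have hR : 0 < R := hρ.trans hρR
  have hsph : ∀ r, 0 < r → r ≤ R → ContinuousOn g (sphere c r) := by
    intro r h0 h1 w hw
    rw [mem_sphere, dist_eq_norm] at hw
    refine (hg w ?_ (hw.trans_le h1)).continuousAt.continuousWithinAt
    rintro rfl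
    simp at hw
    exact h0.ne hw
  let A : ℂ → ℂ := fun z => (2 * Real.pi * I)⁻¹ * ∮ w in C(c, R), (w - z)⁻¹ • g w
  let Q : ℂ → ℂ := fun z => (2 * Real.pi * I)⁻¹ * ∮ w in C(c, ρ), (w - z)⁻¹ • g w
  have hA : ∀ z ∈ ball c R, DifferentiableAt ℂ A z := fun z hz =>
    (differentiableAt_circleIntegral_cauchy (hsph R hR le_rfl) hR.le fun h => by
      rw [mem_ball] at hz; rw [mem_sphere] at h; linarith).const_mul _
  have hQ : ∀ z, ρ < ‖z - c‖ → DifferentiableAt ℂ Q z := fun z hz =>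
    (differentiableAt_circleIntegral_cauchy (hsph ρ hρ hρR.le) hρ.le fun h => by
      rw [mem_sphere, dist_eq_norm] at h; linarith).const_mul _
  have hAQ : ∀ z, ρ < ‖z - c‖ → ‖z - c‖ < R → A z = g z + Q z := by
    intro z h1 h2
    have h3 := cauchy_annulus hρ (fun w hw hw' => hg w (by
      rintro rfl
      simp at hw
      linarith) hw') h1 h2
    have hpi : (2 * Real.pi * I : ℂ) ≠ 0 := two_pi_I_ne_zero
    rw [← sub_eq_iff_eq_add]
    simp only [A, Q]
    rw [← mul_sub, h3, inv_mul_cancel_left₀ hpi]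
  classical
  -- The two branches agree on the annulus `ρ < ‖z - c‖ < R`, so `g₁` is locally one of them.
  let g₁ : ℂ → ℂ := fun z => if ‖z - c‖ < R then A z else g z + Q z
  have hg₁ : ∀ z, ρ < ‖z - c‖ → g₁ z = g z + Q z := by
    intro z hz
    by_cases h : ‖z - c‖ < R
    · simp only [g₁, h, if_true, hAQ z hz h]
    · simp only [g₁, h, if_false]
  refine ⟨g₁, fun z hz => ?_, fun z hz => by rw [hg₁ z hz, sub_neg_eq_add]⟩
  by_cases h : ‖z - c‖ < R
  · have hb : z ∈ ball c R := by rwa [mem_ball, dist_eq_norm]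
    refine (hA z hb).congr_of_eventuallyEq ?_
    filter_upwards [isOpen_ball.mem_nhds hb] with y hy
    rw [mem_ball, dist_eq_norm] at hy
    simp only [g₁, hy, if_true]
  · have hz' : ρ < ‖z - c‖ := hρR.trans_le (not_lt.1 h)
    have hzc : DifferentiableAt ℂ g z := hz.resolve_left fun e => by simp [e, hR] at h
    refine (hzc.add (hQ z hz')).congr_of_eventuallyEq ?_
    have hopen : IsOpen {y : ℂ | ρ < ‖y - c‖} := isOpen_lt continuous_const (by fun_prop)
    filter_upwards [hopen.mem_nhds hz'] with y hy
    exact hg₁ y hy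

open Complex Metric in
/-- **Residue theorem for a rectangle**, with residues written as integrals over small circles. -/
theorem rectIntegral_eventually_eq_sum {z w : ℂ} (S : Finset ℂ) :
    ∀ {g : ℂ → ℂ}, (∀ ζ, ζ ∉ S → DifferentiableAt ℂ g ζ) →
    (∀ s ∈ S, s ∈ Ioo z.re w.re ×ℂ Ioo z.im w.im) → z.re ≤ w.re → z.im ≤ w.im →
    ∀ᶠ r in 𝓝[>] (0 : ℝ), rectIntegral g z w = ∑ s ∈ S, ∮ ζ in C(s, r), g ζ := by
  induction S using Finset.induction_on with
  | empty =>
    intro g hg _ _ _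
    refine Eventually.of_forall fun r => ?_
    rw [Finset.sum_empty]
    exact integral_boundary_rect_eq_zero_of_differentiableOn g z w
      fun ζ _ => (hg ζ (Finset.notMem_empty ζ)).differentiableWithinAt
  | insert c S hc ih =>
    intro g hg hS hre him
    obtain ⟨R, hR, hRS, hRU⟩ : ∃ R > 0, (∀ s ∈ S, R < ‖s - c‖) ∧
        closedBall c R ⊆ Ioo z.re w.re ×ℂ Ioo z.im w.im := by
      have h1 : (Ioo z.re w.re ×ℂ Ioo z.im w.im) ∩ (S : Set ℂ)ᶜ ∈ 𝓝 c :=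
        inter_mem ((isOpen_Ioo.reProdIm isOpen_Ioo).mem_nhds (hS c (Finset.mem_insert_self c S)))
          (S.finite_toSet.isClosed.isOpen_compl.mem_nhds (by simpa using hc))
      obtain ⟨R, hR, h⟩ := nhds_basis_closedBall.mem_iff.1 h1
      refine ⟨R, hR, fun s hs => ?_, fun x hx => (h hx).1⟩
      by_contra! hle
      exact (h (show s ∈ closedBall c R by rwa [mem_closedBall, dist_eq_norm])).2 hs
    have hgc : ∀ ζ, ζ ≠ c → ‖ζ - c‖ ≤ R → DifferentiableAt ℂ g ζ := by
      intro ζ h1 h2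
      refine hg ζ fun h => ?_
      rcases Finset.mem_insert.1 h with h | h
      · exact h1 h
      · exact absurd (hRS ζ h) (not_lt.2 h2)
    have hρ : 0 < R / 2 := by positivity
    have hρR : R / 2 < R := by linarith
    obtain ⟨g₁, hd₁, he₁⟩ := exists_split_principal_part hρ hρR hgc
    set P : ℂ → ℂ := fun ζ =>
      -((2 * Real.pi * I)⁻¹ * ∮ w in C(c, R / 2), (w - ζ)⁻¹ • g w) with hP
    have hsph : ContinuousOn g (sphere c (R / 2)) := by
      intro w hw
      rw [mem_sphere, dist_eq_norm] at hw
      refine (hgc w ?_ (by linarith)).continuousAt.continuousWithinAt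
      rintro rfl
      simp at hw
      linarith
    have hPd : ∀ ζ, R / 2 < ‖ζ - c‖ → DifferentiableAt ℂ P ζ := fun ζ hζ =>
      ((differentiableAt_circleIntegral_cauchy hsph hρ.le fun h => by
        rw [mem_sphere, dist_eq_norm] at h; linarith).const_mul _).neg
    have hbd : ∀ ζ ∈ rectBoundary z w, R < ‖ζ - c‖ := by
      intro ζ hζ
      by_contra! hle
      exact hζ.2 (hRU (by rwa [mem_closedBall, dist_eq_norm]))
    have hrect : rectIntegral g z w = rectIntegral g₁ z w + ∮ ζ in C(c, R / 2), g ζ := by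
      have h1 : rectIntegral g₁ z w = rectIntegral g z w - rectIntegral P z w := by
        rw [← rectIntegral_sub hre him]
        · exact rectIntegral_congr hre him fun ζ hζ => he₁ ζ (hρR.trans (hbd ζ hζ))
        · intro ζ hζ
          refine (hg ζ fun h => hζ.2 (hS ζ h)).continuousAt.continuousWithinAt
        · intro ζ hζ
          exact (hPd ζ (hρR.trans (hbd ζ hζ))).continuousAt.continuousWithinAt
      have h2 : rectIntegral P z w = ∮ ζ in C(c, R / 2), g ζ := by
        have h3 := rectIntegral_cauchy hρ.le hsph hre him
          ((sphere_subset_closedBall.trans (closedBall_subset_closedBall hρR.le)).trans hRU)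
        have h4 : rectIntegral P z w = -((2 * Real.pi * I)⁻¹ *
            rectIntegral (fun ζ => ∮ w in C(c, R / 2), (w - ζ)⁻¹ • g w) z w) := by
          simp only [rectIntegral, hP, intervalIntegral.integral_neg,
            intervalIntegral.integral_const_mul, smul_eq_mul]
          ring
        rw [h4, h3]
        field_simp [two_pi_I_ne_zero]
      rw [h1, h2]
      ring
    have hS₁ : ∀ s ∈ S, ∀ᶠ r in 𝓝[>] (0 : ℝ),
        (∮ ζ in C(s, r), g₁ ζ) = ∮ ζ in C(s, r), g ζ := by
      intro s hs
      -- Near `s` the functions `g₁` and `g` differ by `P`, which is holomorphic there.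
      have hUo : IsOpen ({y : ℂ | R < ‖y - c‖} ∩ ((insert c S).erase s : Finset ℂ)ᶜ) :=
        (isOpen_lt continuous_const (by fun_prop)).inter
          (((insert c S).erase s).finite_toSet.isClosed.isOpen_compl)
      have hsU : s ∈ {y : ℂ | R < ‖y - c‖} ∩ ((insert c S).erase s : Finset ℂ)ᶜ :=
        ⟨hRS s hs, by simp⟩
      obtain ⟨δ, hδ, hδU⟩ := nhds_basis_closedBall.mem_iff.1 (hUo.mem_nhds hsU)
      filter_upwards [Ioo_mem_nhdsGT hδ] with r hr
      have hsub : closedBall s r ⊆ _ := (closedBall_subset_closedBall hr.2.le).trans hδU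
      have hball : ∀ ζ ∈ closedBall s r, R / 2 < ‖ζ - c‖ := fun ζ hζ =>
        hρR.trans (hsub hζ).1
      have h0 : (∮ ζ in C(s, r), P ζ) = 0 :=
        circleIntegral_eq_zero_of_differentiable_on_off_countable hr.1.le countable_empty
          (fun ζ hζ => (hPd ζ (hball ζ hζ)).continuousAt.continuousWithinAt)
          fun ζ hζ => hPd ζ (hball ζ (ball_subset_closedBall hζ.1))
      have h1 : (∮ ζ in C(s, r), g₁ ζ) = ∮ ζ in C(s, r), (g ζ - P ζ) :=
        circleIntegral.integral_congr hr.1.le fun ζ hζ =>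
          he₁ ζ (hball ζ (sphere_subset_closedBall hζ))
      rw [h1, circleIntegral.integral_sub, h0, sub_zero]
      · refine ContinuousOn.circleIntegrable hr.1.le fun ζ hζ => ?_
        refine (hg ζ fun h => ?_).continuousAt.continuousWithinAt
        refine (hsub (sphere_subset_closedBall hζ)).2 ?_
        rw [Finset.mem_coe, Finset.mem_erase]
        refine ⟨?_, h⟩
        rintro rfl
        rw [mem_sphere, dist_self] at hζ
        exact hr.1.ne hζ
      · exact ContinuousOn.circleIntegrable hr.1.le fun ζ hζ =>
          (hPd ζ (hball ζ (sphere_subset_closedBall hζ))).continuousAt.continuousWithinAt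
    have hih := ih (g := g₁) (fun ζ hζ => hd₁ ζ (by
      by_cases h : ζ = c
      · exact Or.inl h
      · exact Or.inr (hg ζ (by simp [h, hζ])))) (fun s hs => hS s (Finset.mem_insert_of_mem hs))
      hre him
    filter_upwards [hih, (S.eventually_all).2 hS₁, circleIntegral_eventually_eq hρ
      fun ζ h1 h2 => hgc ζ h1 (h2.trans hρR.le)] with r h1 h2 h3
    rw [Finset.sum_insert hc, h3, hrect, h1, Finset.sum_congr rfl h2, add_comm]

open Complex Metric in
/-- The limit defining the residue exists at every isolated singularity. -/
theorem tendsto_residue {g : ℂ → ℂ} {S : Finset ℂ} (hg : ∀ ζ, ζ ∉ S → DifferentiableAt ℂ g ζ)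
    (s : ℂ) :
    Tendsto (fun r : ℝ => (2 * (Real.pi : ℂ) * I)⁻¹ * ∮ w in C(s, r), g w) (𝓝[>] 0)
      (𝓝 (residue g s)) := by
  have hmem : ((S.erase s : Finset ℂ) : Set ℂ)ᶜ ∈ 𝓝 s :=
    (S.erase s).finite_toSet.isClosed.isOpen_compl.mem_nhds (by simp)
  obtain ⟨R, hR, hRS⟩ := nhds_basis_closedBall.mem_iff.1 hmem
  have hev := circleIntegral_eventually_eq (g := g) (c := s) hR fun ζ h1 h2 => hg ζ fun h =>
    hRS (show ζ ∈ closedBall s R by rwa [mem_closedBall, dist_eq_norm]) (by simp [h, h1])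
  refine tendsto_nhds_limUnder ⟨(2 * (Real.pi : ℂ) * I)⁻¹ * ∮ w in C(s, R), g w, ?_⟩
  refine tendsto_const_nhds.congr' ?_
  filter_upwards [hev] with r hr
  rw [hr]

open Complex in
/-- **Residue theorem for a rectangle.** -/
theorem rectIntegral_eq_sum_residue {g : ℂ → ℂ} {z w : ℂ} {S : Finset ℂ}
    (hg : ∀ ζ, ζ ∉ S → DifferentiableAt ℂ g ζ)
    (hS : ∀ s ∈ S, s ∈ Ioo z.re w.re ×ℂ Ioo z.im w.im) (hre : z.re ≤ w.re) (him : z.im ≤ w.im) :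
    (2 * (Real.pi : ℂ) * I)⁻¹ * rectIntegral g z w = ∑ s ∈ S, residue g s := by
  refine tendsto_nhds_unique ?_
    (tendsto_finsetSum S fun s _ => tendsto_residue hg s)
  refine tendsto_const_nhds.congr' ?_
  filter_upwards [rectIntegral_eventually_eq_sum S hg hS hre him] with r hr
  rw [hr, Finset.mul_sum]

/-! ### Closing the vertical line to the left -/

theorem integral_exp_mul_le {a t R : ℝ} (ht : 0 < t) :
    ∫ x in (a - R)..a, Real.exp (x * t) ≤ Real.exp (a * t) / t := by
  rw [intervalIntegral.integral_comp_mul_right _ ht.ne', integral_exp, smul_eq_mul, div_eq_inv_mul]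
  gcongr
  linarith [Real.exp_pos ((a - R) * t)]

open Complex in
/-- Closing the contour to the left by the other three sides of `[a - R, a] × [-R, R]`: the distance
of the truncated integral to the sum of the residues is controlled by the size `ε` of `F` far out in
the left half-plane. -/
theorem norm_verticalSegmentIntegral_sub_residues_le {F : ℂ → ℂ} {S : Finset ℂ} {a t ε M R : ℝ}
    (hS : ∀ s ∈ S, s.re < a) (hF : ∀ y, y ∉ S → DifferentiableAt ℂ F y) (hε : 0 ≤ ε)
    (hM : ∀ y : ℂ, y.re ≤ a → M ≤ ‖y‖ → ‖F y‖ ≤ ε) (ht : 0 < t) (hR : 0 < R)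
    (hMR : M + |a| ≤ R) (hSR : ∀ s ∈ S, ‖s‖ + |a| < R) :
    ‖verticalSegmentIntegral (fun y => F y * exp (y * t)) a R -
      ∑ s ∈ S, residue (fun y => F y * exp (y * t)) s‖ ≤ ε * (4 * Real.exp (a * t) / t) := by
  set g : ℂ → ℂ := fun y => F y * exp (y * t) with hg
  have hgd : ∀ y, y ∉ S → DifferentiableAt ℂ g y := fun y hy =>
    (hF y hy).mul (by fun_prop)
  have hgn : ∀ y : ℂ, y.re ≤ a → M ≤ ‖y‖ → ‖g y‖ ≤ ε * Real.exp (y.re * t) := by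
    intro y h1 h2
    rw [hg, norm_mul, norm_exp]
    have h3 : (y * t).re = y.re * t := by simp
    rw [h3]
    have := hM y h1 h2
    gcongr
  have hle := neg_abs_le a
  have hle' := le_abs_self a
  -- The hypotheses on `R` put every singularity inside the rectangle `[a - R, a] × [-R, R]`.
  have hres := rectIntegral_eq_sum_residue (z := ⟨a - R, -R⟩) (w := ⟨a, R⟩) hgd
    (fun s hs => by
      have h1 := hSR s hs
      have h2 := abs_le.1 (abs_re_le_norm s)
      have h3 := abs_le.1 (abs_im_le_norm s)
      have h4 := abs_nonneg a
      exact ⟨⟨by simp only; linarith, hS s hs⟩, by simp only; linarith, by simp only; linarith⟩)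
    (by simp only; linarith) (by simp only; linarith)
  have hhor : ∀ c : ℝ, |c| = R → ‖∫ x : ℝ in (a - R)..a, g (x + c * I)‖ ≤
      ε * (Real.exp (a * t) / t) := by
    intro c hc
    have h1 : ‖∫ x : ℝ in (a - R)..a, g (x + c * I)‖ ≤
        ∫ x in (a - R)..a, ε * Real.exp (x * t) := by
      refine intervalIntegral.norm_integral_le_of_norm_le (by linarith)
        (Eventually.of_forall fun x hx => ?_)
        ((by fun_prop : Continuous fun x => ε * Real.exp (x * t)).intervalIntegrable _ _)
      have h2 := hgn (x + c * I) (by simpa using hx.2) (by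
        have h3 := abs_im_le_norm (x + c * I)
        simp only [add_im, ofReal_im, mul_im, ofReal_re, I_im, mul_one, I_re, mul_zero, add_zero,
          zero_add, hc] at h3
        linarith [abs_nonneg a])
      simpa using h2
    refine h1.trans ?_
    rw [intervalIntegral.integral_const_mul]
    exact mul_le_mul_of_nonneg_left (integral_exp_mul_le ht) hε
  have hver : ‖∫ y : ℝ in (-R)..R, g ((a - R : ℝ) + y * I)‖ ≤ ε * (2 * Real.exp (a * t) / t) := by
    have h1 : ‖∫ y : ℝ in (-R)..R, g ((a - R : ℝ) + y * I)‖ ≤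
        ε * Real.exp ((a - R) * t) * |R - -R| := by
      refine intervalIntegral.norm_integral_le_of_norm_le_const fun y _ => ?_
      have h2 := hgn ((a - R : ℝ) + y * I) (by simp; linarith) (by
        have h3 := (abs_le.1 (abs_re_le_norm ((a - R : ℝ) + y * I))).1
        simp only [add_re, ofReal_re, mul_re, I_re, mul_zero, ofReal_im, I_im, mul_one, sub_self,
          add_zero] at h3
        linarith)
      simpa using h2
    refine h1.trans ?_
    -- The left edge has length `2 * R`, absorbed by the factor `exp (-R * t) ≤ (R * t)⁻¹`.
    have h3 : R * t ≤ Real.exp (R * t) := by linarith [Real.add_one_le_exp (R * t)]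
    have h4 : Real.exp ((a - R) * t) * Real.exp (R * t) = Real.exp (a * t) := by
      rw [← Real.exp_add]; ring_nf
    have h5 : Real.exp ((a - R) * t) * (R * t) ≤ Real.exp (a * t) := by
      rw [← h4]; gcongr
    rw [abs_of_pos (by linarith), mul_assoc]
    refine mul_le_mul_of_nonneg_left ?_ hε
    rw [le_div_iff₀ ht]
    nlinarith
  have hb := hhor (-R) (by rw [abs_neg, abs_of_pos hR])
  have htop := hhor R (abs_of_pos hR)
  have hkey : verticalSegmentIntegral g a R - ∑ s ∈ S, residue g s = (2 * (Real.pi : ℂ) * I)⁻¹ *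
      ((∫ x : ℝ in (a - R)..a, g (x + R * I)) - (∫ x : ℝ in (a - R)..a, g (x + (-R : ℝ) * I)) +
        I * ∫ y : ℝ in (-R)..R, g ((a - R : ℝ) + y * I)) := by
    rw [← hres, verticalSegmentIntegral, ← mul_sub, rectIntegral,
      intervalIntegral.integral_mul_const]
    simp only [smul_eq_mul]
    ring
  have hpi : ‖(2 * (Real.pi : ℂ) * I)⁻¹‖ ≤ 1 := by
    rw [norm_inv, norm_mul, norm_I, mul_one, norm_mul, norm_real, Real.norm_eq_abs,
      abs_of_pos Real.pi_pos]
    refine inv_le_one_of_one_le₀ ?_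
    simp only [norm_ofNat]
    linarith [Real.pi_gt_three]
  rw [hkey, norm_mul]
  refine (mul_le_of_le_one_left (norm_nonneg _) hpi).trans ?_
  refine (norm_add_le _ _).trans ?_
  rw [norm_mul, norm_I, one_mul]
  refine (add_le_add ((norm_sub_le _ _).trans (add_le_add htop hb)) hver).trans (le_of_eq ?_)
  ring

open Complex in
/-- The truncated inversion integrals converge to the sum of the residues, locally uniformly in the
variable of the original function. -/
theorem tendstoLocallyUniformlyOn_verticalSegmentIntegral {F : ℂ → ℂ} {S : Finset ℂ} {a : ℝ}
    (hS : ∀ s ∈ S, s.re < a) (hF : ∀ y, y ∉ S → DifferentiableAt ℂ F y)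
    (hlim : Tendsto F (Bornology.cobounded ℂ ⊓ 𝓟 {y : ℂ | y.re ≤ a}) (𝓝 0)) :
    TendstoLocallyUniformlyOn
      (fun (R t : ℝ) => verticalSegmentIntegral (fun y => F y * exp (y * t)) a R)
      (fun t : ℝ => ∑ s ∈ S, residue (fun y => F y * exp (y * t)) s) atTop (Ioi 0) := by
  rw [tendstoLocallyUniformlyOn_iff_forall_isCompact isOpen_Ioi]
  intro K hK hKc
  have hcont : ContinuousOn (fun t : ℝ => 4 * Real.exp (a * t) / t) K :=
    ContinuousOn.div (by fun_prop) continuousOn_id fun t h => (hK h).ne'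
  obtain ⟨B, hB⟩ := hKc.exists_bound_of_continuousOn hcont
  rw [Metric.tendstoUniformlyOn_iff]
  intro δ hδ
  set ε : ℝ := δ / (2 * (|B| + 1)) with hε
  have hε0 : 0 < ε := by positivity
  obtain ⟨M, hM⟩ : ∃ M : ℝ, ∀ y : ℂ, y.re ≤ a → M ≤ ‖y‖ → ‖F y‖ ≤ ε := by
    have h1 := hlim.eventually (Metric.closedBall_mem_nhds 0 hε0)
    rw [eventually_inf_principal, ← comap_norm_atTop, eventually_comap] at h1
    obtain ⟨M, h2⟩ := eventually_atTop.1 h1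
    exact ⟨M, fun y hy hMy => by simpa using h2 ‖y‖ hMy y rfl hy⟩
  have hSR : ∀ᶠ R : ℝ in atTop, ∀ s ∈ S, ‖s‖ + |a| < R :=
    (S.eventually_all).2 fun s _ => eventually_gt_atTop _
  filter_upwards [eventually_gt_atTop 0, eventually_ge_atTop (M + |a|), hSR] with R h1 h2 h3
  intro t ht
  rw [dist_comm, dist_eq_norm]
  refine (norm_verticalSegmentIntegral_sub_residues_le hS hF hε0.le hM (hK ht) h1 h2 h3).trans_lt ?_
  have h4 : 4 * Real.exp (a * t) / t ≤ |B| + 1 :=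
    ((le_abs_self _).trans (hB t ht)).trans (by linarith [le_abs_self B])
  calc ε * (4 * Real.exp (a * t) / t) ≤ ε * (|B| + 1) := by gcongr
    _ = δ / 2 := by rw [hε]; field_simp
    _ < δ := by linarith

/-! ### Fourier inversion from locally uniform convergence -/

theorem continuous_fourier_of_integrable {G : ℝ → ℂ} (hG : Integrable G) : Continuous (𝓕 G) :=
  VectorFourier.fourierIntegral_continuous Real.continuous_fourierChar
    (by fun_prop) hG

theorem norm_fourier_le_integral_norm (G : ℝ → ℂ) (ξ : ℝ) : ‖𝓕 G ξ‖ ≤ ∫ x, ‖G x‖ :=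
  VectorFourier.norm_fourierIntegral_le_integral_norm Real.fourierChar volume (innerₗ ℝ) G ξ

/-- The truncated Fourier inversion integral at `u`. -/
def fourierPartialInv (G : ℝ → ℂ) (R u : ℝ) : ℂ :=
  ∫ ξ in (-R)..R, 𝓕 G ξ * Complex.exp (2 * Real.pi * ξ * u * Complex.I)

theorem continuous_fourierPartialInv {G : ℝ → ℂ} (hG : Integrable G) (R : ℝ) :
    Continuous (fourierPartialInv G R) := by
  have hc := continuous_fourier_of_integrable hG
  unfold fourierPartialInv
  refine intervalIntegral.continuous_parametric_intervalIntegral_of_continuous' ?_ _ _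
  simp only [Function.uncurry_def]
  have : Continuous fun p : ℝ × ℝ => 𝓕 G p.2 := hc.comp continuous_snd
  fun_prop

/-- Fubini for the truncated inversion integral against an integrable function. -/
theorem integral_mul_fourierPartialInv {G φ : ℝ → ℂ} (hG : Integrable G) (hφ : Integrable φ)
    {R : ℝ} (hR : 0 ≤ R) :
    ∫ u, φ u * fourierPartialInv G R u = ∫ ξ in (-R)..R, 𝓕 G ξ * 𝓕⁻ φ ξ := by
  have hc := continuous_fourier_of_integrable hG
  have hRR : -R ≤ R := by linarith
  have hint : Integrable
      (fun p : ℝ × ℝ => Complex.exp (2 * Real.pi * p.2 * p.1 * Complex.I) * (φ p.1 * 𝓕 G p.2))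
      ((volume : Measure ℝ).prod (volume.restrict (Ioc (-R) R))) := by
    refine Integrable.bdd_mul (c := 1) (hφ.mul_prod
      ((hc.intervalIntegrable (-R) R).1)) ?_ ?_
    · exact (by fun_prop : Continuous fun p : ℝ × ℝ =>
        Complex.exp (2 * Real.pi * p.2 * p.1 * Complex.I)).aestronglyMeasurable
    · refine Eventually.of_forall fun p => le_of_eq ?_
      have : (2 * Real.pi * p.2 * p.1 * Complex.I : ℂ) =
        ((2 * Real.pi * p.2 * p.1 : ℝ) : ℂ) * Complex.I := by push_cast; ring
      rw [this, Complex.norm_exp_ofReal_mul_I]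
  simp only [fourierPartialInv, intervalIntegral.integral_of_le hRR]
  have h1 : ∀ u, φ u * ∫ ξ in Ioc (-R) R,
      𝓕 G ξ * Complex.exp (2 * Real.pi * ξ * u * Complex.I) =
      ∫ ξ in Ioc (-R) R, Complex.exp (2 * Real.pi * ξ * u * Complex.I) * (φ u * 𝓕 G ξ) := by
    intro u
    rw [← integral_const_mul]
    congr 1 with ξ
    ring
  simp only [h1]
  rw [integral_integral_swap hint]
  congr 1 with ξ
  rw [Real.fourierInv_eq', ← integral_const_mul]
  congr 1 with u
  simp only [smul_eq_mul, RCLike.inner_apply, conj_trivial]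
  push_cast
  ring_nf

open scoped ContDiff in
/-- Pairing with a test function: the truncated inversion integrals of an integrable function
converge to it weakly. -/
theorem tendsto_integral_mul_fourierPartialInv {G φ : ℝ → ℂ} (hG : Integrable G)
    (hφ : ContDiff ℝ ∞ φ) (hφc : HasCompactSupport φ) :
    Tendsto (fun R => ∫ u, φ u * fourierPartialInv G R u) atTop (𝓝 (∫ u, φ u * G u)) := by
  have hφi : Integrable φ := hφ.continuous.integrable_of_hasCompactSupport hφc
  set ψ : SchwartzMap ℝ ℂ := hφc.toSchwartzMap hφ
  have hψ : (ψ : ℝ → ℂ) = φ := rfl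
  have hinv : ((𝓕⁻ ψ : SchwartzMap ℝ ℂ) : ℝ → ℂ) = 𝓕⁻ φ := by
    rw [SchwartzMap.fourierInv_coe, hψ]
  have hinvi : Integrable (𝓕⁻ φ) := by
    rw [← hinv]
    exact (𝓕⁻ ψ : SchwartzMap ℝ ℂ).integrable
  have hback : 𝓕 (𝓕⁻ φ) = φ := by
    rw [← hinv, ← SchwartzMap.fourier_coe, FourierTransform.fourier_fourierInv_eq, hψ]
  have hprod : Integrable fun ξ => 𝓕 G ξ * 𝓕⁻ φ ξ :=
    hinvi.bdd_mul (continuous_fourier_of_integrable hG).aestronglyMeasurable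
      (Eventually.of_forall (norm_fourier_le_integral_norm G))
  have hself : ∫ ξ, 𝓕 G ξ * 𝓕⁻ φ ξ = ∫ u, φ u * G u := by
    have h1 := VectorFourier.integral_fourierIntegral_smul_eq_flip (L := innerₗ ℝ)
      Real.continuous_fourierChar (by fun_prop) hG hinvi
    rw [flip_innerₗ] at h1
    refine h1.trans (integral_congr_ae (Eventually.of_forall fun u => ?_))
    change G u * 𝓕 (𝓕⁻ φ) u = φ u * G u
    rw [hback, mul_comm]
  rw [← hself]
  refine (intervalIntegral_tendsto_integral hprod tendsto_neg_atTop_atBot tendsto_id).congr' ?_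
  filter_upwards [eventually_ge_atTop 0] with R hR
  exact (integral_mul_fourierPartialInv hG hφi hR).symm

/-- **Fourier inversion from locally uniform convergence**: if the truncated inversion integrals of
an integrable function converge locally uniformly on an open set, then their limit is almost
everywhere the function. -/
theorem ae_eq_of_tendstoLocallyUniformlyOn_fourierPartialInv {G w : ℝ → ℂ} {U : Set ℝ}
    (hG : Integrable G) (hU : IsOpen U)
    (h : TendstoLocallyUniformlyOn (fourierPartialInv G) w atTop U) :
    ∀ᵐ u, u ∈ U → G u = w u := by
  have hw : ContinuousOn w U := h.continuousOn
    (Frequently.of_forall fun R => (continuous_fourierPartialInv hG R).continuousOn)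
  have hae : ∀ᵐ u, u ∈ U → G u - w u = 0 := by
    refine hU.ae_eq_zero_of_integral_contDiff_smul_eq_zero
      ((hG.locallyIntegrable.locallyIntegrableOn U).sub
        (hw.locallyIntegrableOn hU.measurableSet)) fun φ hφ hφc hφU => ?_
    have hφ0 : ∀ u, u ∉ tsupport φ → φ u = 0 := fun u hu => image_eq_zero_of_notMem_tsupport hu
    have hsupp : ∀ {F : ℝ → ℂ}, (∀ u, u ∉ tsupport φ → F u = 0) →
        ContinuousOn F (tsupport φ) → Integrable F := by
      intro F hF hFc
      refine (integrableOn_iff_integrable_of_support_subset fun u hu => ?_).1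
        (hFc.integrableOn_compact hφc)
      by_contra hn
      exact hu (hF u hn)
    have hφcont := hφ.continuous
    have hφ' : ContDiff ℝ (⊤ : ℕ∞) fun u => (φ u : ℂ) := Complex.ofRealCLM.contDiff.comp hφ
    have hφc' : HasCompactSupport fun u => (φ u : ℂ) := hφc.comp_left Complex.ofReal_zero
    have hwi : Integrable fun u => (φ u : ℂ) * w u :=
      hsupp (fun u hu => by simp [hφ0 u hu]) ((by fun_prop : Continuous fun u =>
        (φ u : ℂ)).continuousOn.mul (hw.mono hφU))
    have hGi : Integrable fun u => (φ u : ℂ) * G u := by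
      obtain ⟨C, hC⟩ := hφ'.continuous.bounded_above_of_compact_support hφc'
      exact hG.bdd_mul hφ'.continuous.aestronglyMeasurable (Eventually.of_forall hC)
    have hlimw : Tendsto (fun R => ∫ u, (φ u : ℂ) * fourierPartialInv G R u) atTop
        (𝓝 (∫ u, (φ u : ℂ) * w u)) := by
      have hunif := Metric.tendstoUniformlyOn_iff.1
        ((tendstoLocallyUniformlyOn_iff_forall_isCompact hU).1 h (tsupport φ) hφU hφc)
      refine tendsto_integral_filter_of_dominated_convergence
        (fun u => ‖(φ u : ℂ) * w u‖ + ‖(φ u : ℂ)‖) ?_ ?_ ?_ ?_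
      · exact Eventually.of_forall fun R => (hφ'.continuous.mul
          (continuous_fourierPartialInv hG R)).aestronglyMeasurable
      · filter_upwards [hunif 1 one_pos] with R hR
        refine Eventually.of_forall fun u => ?_
        by_cases hu : u ∈ tsupport φ
        · have h1 := (hR u hu).le
          rw [dist_comm, dist_eq_norm] at h1
          have h2 : ‖fourierPartialInv G R u‖ ≤ ‖w u‖ + 1 := by
            have := norm_sub_norm_le (fourierPartialInv G R u) (w u)
            linarith
          rw [norm_mul, norm_mul]
          nlinarith [norm_nonneg (φ u : ℂ)]
        · simp [hφ0 u hu]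
      · exact hwi.norm.add (hφ'.continuous.integrable_of_hasCompactSupport hφc').norm
      · refine Eventually.of_forall fun u => ?_
        by_cases hu : u ∈ tsupport φ
        · exact (h.tendsto_at (hφU hu)).const_mul _
        · simp [hφ0 u hu]
    have heq := tendsto_nhds_unique (tendsto_integral_mul_fourierPartialInv hG hφ' hφc') hlimw
    have hfun : (fun u => φ u • (G u - w u)) =
        fun u => (φ u : ℂ) * G u - (φ u : ℂ) * w u := by
      ext u
      rw [Complex.real_smul, mul_sub]
    rw [hfun, integral_sub hGi hwi, heq, sub_self]
  filter_upwards [hae] with u hu hU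
  exact sub_eq_zero.1 (hu hU)

/-! ### From the transform of order `n` to the Fourier transform -/

theorem LnIntegrand_cpow_one_div {n : ℕ} (hn : n ≠ 0) (f : ℝ → ℂ) (y : ℂ) (x : ℝ) :
    LnIntegrand n f (y ^ (1 / (n : ℂ))) x =
      (x : ℂ) ^ (n - 1) * Complex.exp (-(x : ℂ) ^ n * y) * f x := by
  rw [LnIntegrand, one_div, Complex.cpow_nat_inv_pow y hn]

/-- The function `u ↦ exp (-a u) * f (u ^ (1 / n))` on `(0, ∞)`, extended by `0`. Substituting
`u = x ^ n` turns the transform of order `n` of `f` on the line `Re y = a` into its Fourier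
transform. -/
def dampedRoot (n : ℕ) (f : ℝ → ℂ) (a : ℝ) : ℝ → ℂ :=
  (Ioi 0).indicator fun u => Complex.exp (-(a * u)) * f (u ^ (1 / (n : ℝ)))

theorem rpow_pow_one_div {n : ℕ} (hn : n ≠ 0) {x : ℝ} (hx : 0 ≤ x) :
    (x ^ n) ^ (1 / (n : ℝ)) = x := by
  rw [one_div, Real.pow_rpow_inv_natCast hx hn]

theorem rpow_natCast_sub_one {n : ℕ} (hn : n ≠ 0) (x : ℝ) :
    x ^ ((n : ℝ) - 1) = x ^ (n - 1) := by
  rw [← Real.rpow_natCast, Nat.cast_sub (Nat.one_le_iff_ne_zero.2 hn), Nat.cast_one]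

theorem integrable_dampedRoot {n : ℕ} (hn : n ≠ 0) {f : ℝ → ℂ} {a : ℝ}
    (h : LnConvergent n f ((a : ℂ) ^ (1 / (n : ℂ)))) : Integrable (dampedRoot n f a) := by
  have hn' : (n : ℝ) ≠ 0 := Nat.cast_ne_zero.2 hn
  rw [dampedRoot, integrable_indicator_iff measurableSet_Ioi,
    ← integrableOn_Ioi_comp_rpow_iff' _ hn']
  refine IntegrableOn.congr_fun h (fun x hx => ?_) measurableSet_Ioi
  have hx0 : (0 : ℝ) ≤ x := le_of_lt hx
  rw [LnIntegrand_cpow_one_div hn, Real.rpow_natCast, rpow_pow_one_div hn hx0,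
    rpow_natCast_sub_one hn, Complex.real_smul]
  push_cast
  ring_nf

theorem fourier_dampedRoot {n : ℕ} (hn : n ≠ 0) (f : ℝ → ℂ) (a ξ : ℝ) :
    𝓕 (dampedRoot n f a) ξ =
      n * Ln n f (((a : ℂ) + (2 * Real.pi * ξ : ℝ) * Complex.I) ^ (1 / (n : ℂ))) := by
  have hn' : (0 : ℝ) < n := Nat.cast_pos.2 (Nat.pos_of_ne_zero hn)
  have h1 : 𝓕 (dampedRoot n f a) ξ = ∫ u in Ioi (0 : ℝ),
      Complex.exp (-(u * ((a : ℂ) + (2 * Real.pi * ξ : ℝ) * Complex.I))) *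
        f (u ^ (1 / (n : ℝ))) := by
    rw [Real.fourier_real_eq_integral_exp_smul, ← integral_indicator measurableSet_Ioi]
    congr 1 with u
    by_cases hu : u ∈ Ioi (0 : ℝ)
    · rw [indicator_of_mem hu, dampedRoot, indicator_of_mem hu, smul_eq_mul, ← mul_assoc,
        ← Complex.exp_add]
      congr 2
      push_cast
      ring
    · rw [indicator_of_notMem hu, dampedRoot, indicator_of_notMem hu, smul_zero]
  rw [h1, ← integral_comp_rpow_Ioi_of_pos hn', Ln, ← integral_const_mul]
  refine setIntegral_congr_fun measurableSet_Ioi fun x hx => ?_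
  have hx0 : (0 : ℝ) ≤ x := le_of_lt hx
  rw [LnIntegrand_cpow_one_div hn, Real.rpow_natCast, rpow_pow_one_div hn hx0,
    rpow_natCast_sub_one hn, Complex.real_smul]
  push_cast
  ring_nf

/-- On the line `Re y = a` the inversion integral of the transform is a Fourier inversion
integral. -/
theorem fourierPartialInv_dampedRoot {n : ℕ} (hn : n ≠ 0) {f : ℝ → ℂ} {a : ℝ} {F : ℂ → ℂ}
    (hFf : ∀ y : ℂ, a ≤ y.re → F y = Ln n f (y ^ (1 / (n : ℂ)))) (R u : ℝ) :
    fourierPartialInv (dampedRoot n f a) R u = Complex.exp (-(a * u)) *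
      verticalSegmentIntegral (fun y => n * F y * Complex.exp (y * u)) a (2 * Real.pi * R) := by
  have hpi : (2 * Real.pi : ℝ) ≠ 0 := by positivity
  have h1 := intervalIntegral.integral_comp_mul_left (a := -R) (b := R)
    (fun t : ℝ => (n * F ((a : ℂ) + t * Complex.I) *
      Complex.exp (((a : ℂ) + t * Complex.I) * u)) * Complex.I) hpi
  rw [mul_neg] at h1
  have h2 : (∫ t in -(2 * Real.pi * R)..(2 * Real.pi * R), (n * F ((a : ℂ) + t * Complex.I) *
      Complex.exp (((a : ℂ) + t * Complex.I) * u)) * Complex.I) = (2 * Real.pi : ℝ) •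
      ∫ ξ in (-R)..R, (n * F ((a : ℂ) + (2 * Real.pi * ξ : ℝ) * Complex.I) *
        Complex.exp (((a : ℂ) + (2 * Real.pi * ξ : ℝ) * Complex.I) * u)) * Complex.I := by
    rw [h1, smul_smul, mul_inv_cancel₀ hpi, one_smul]
  have h3 : (∫ ξ in (-R)..R, n * F ((a : ℂ) + (2 * Real.pi * ξ : ℝ) * Complex.I) *
      Complex.exp (((a : ℂ) + (2 * Real.pi * ξ : ℝ) * Complex.I) * u)) =
        Complex.exp (a * u) * fourierPartialInv (dampedRoot n f a) R u := by
    rw [fourierPartialInv, ← intervalIntegral.integral_const_mul]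
    refine intervalIntegral.integral_congr fun ξ _ => ?_
    rw [fourier_dampedRoot hn, ← hFf _ (by simp), add_mul, Complex.exp_add]
    push_cast
    ring_nf
  have h4 : Complex.exp (-(a * u)) * Complex.exp (a * u) = 1 := by
    rw [← Complex.exp_add, neg_add_cancel, Complex.exp_zero]
  have h5 : (2 * Real.pi * Complex.I : ℂ)⁻¹ * (2 * Real.pi * Complex.I) = 1 :=
    inv_mul_cancel₀ Complex.two_pi_I_ne_zero
  rw [verticalSegmentIntegral, h2, Complex.real_smul, intervalIntegral.integral_mul_const, h3]
  push_cast
  linear_combination -(fourierPartialInv (dampedRoot n f a) R u) *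
    ((2 * Real.pi * Complex.I : ℂ)⁻¹ * (2 * Real.pi * Complex.I) * h4 + h5)

/-- Two functions that agree almost everywhere on an open set agree at every point of it at which
both are continuous. -/
theorem eq_of_ae_eq_of_continuousAt {f g : ℝ → ℂ} {U : Set ℝ} (hU : IsOpen U)
    (h : ∀ᵐ x, x ∈ U → f x = g x) {x : ℝ} (hx : x ∈ U) (hf : ContinuousAt f x)
    (hg : ContinuousAt g x) : f x = g x := by
  by_contra hne
  have h1 : ∀ᶠ y in 𝓝 x, f y ≠ g y := by
    filter_upwards [(hf.sub hg).eventually_ne (sub_ne_zero.2 hne)] with y hy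
    exact sub_ne_zero.1 hy
  have h2 : ∃ᶠ y in 𝓝 x, y ∈ U → f y = g y :=
    mem_closure_iff_frequently.1 (Measure.dense_of_ae h x)
  obtain ⟨y, hy, hy1, hy2⟩ := (h2.and_eventually (h1.and (hU.mem_nhds hx))).exists
  exact hy1 (hy hy2)

/-- An almost everywhere property on `(0, ∞)` pulls back along `x ↦ x ^ n`. -/
theorem ae_comp_pow_of_ae {n : ℕ} (hn : n ≠ 0) {p : ℝ → Prop} (h : ∀ᵐ u : ℝ, 0 < u → p u) :
    ∀ᵐ x : ℝ, 0 < x → p (x ^ n) := by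
  set N : Set ℝ := {u | ¬(0 < u → p u)} with hN
  have hNpos : ∀ u ∈ N, 0 < u := fun u hu => (Classical.not_imp.1 hu).1
  have hd : DifferentiableOn ℝ (fun u : ℝ => u ^ (1 / (n : ℝ))) N := fun u hu =>
    (Real.differentiableAt_rpow_const_of_ne _ (hNpos u hu).ne').differentiableWithinAt
  refine measure_mono_null (fun x hx => ?_)
    (addHaar_image_eq_zero_of_differentiableOn_of_addHaar_eq_zero volume hd h)
  obtain ⟨hx0, hxp⟩ := Classical.not_imp.1 hx
  exact ⟨x ^ n, Classical.not_imp.2 ⟨pow_pos hx0 n, hxp⟩, rpow_pow_one_div hn hx0.le⟩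

end

/-- `F` is the analytic continuation of `y ↦ ℒ_n{f; y^{1/n}}`; it is single-valued and analytic off
the finite set `S` (so `y = 0` is not a branch point), and on `Re y ≥ a` it is the integral. -/
theorem theorem2p3 (n : ℕ) (hn : ∃ k : ℕ, n = 2 ^ k) (f : ℝ → ℂ) (a : ℝ)
    (F : ℂ → ℂ) (S : Finset ℂ)
    (hS : ∀ s ∈ S, s.re < a)
    (hF : AnalyticOnNhd ℂ F ((S : Set ℂ)ᶜ))
    (hconv : ∀ y : ℂ, a ≤ y.re → LnConvergent n f (y ^ (1 / (n : ℂ))))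
    (hFf : ∀ y : ℂ, a ≤ y.re → F y = Ln n f (y ^ (1 / (n : ℂ))))
    (hlim : Tendsto F (Bornology.cobounded ℂ ⊓ 𝓟 {y : ℂ | y.re ≤ a}) (𝓝 0)) :
    (∀ x : ℝ, 0 < x →
      HasVerticalLineIntegral (inversionIntegrand n F x) a
        (∑ s ∈ S, residue (inversionIntegrand n F x) s)) ∧
    (∀ᵐ x : ℝ, 0 < x →
      HasVerticalLineIntegral (inversionIntegrand n F x) a (f x) ∧
        f x = ∑ s ∈ S, residue (inversionIntegrand n F x) s) ∧
    (∀ x : ℝ, 0 < x → ContinuousAt f x →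
      HasVerticalLineIntegral (inversionIntegrand n F x) a (f x) ∧
        f x = ∑ s ∈ S, residue (inversionIntegrand n F x) s) := by
  have hn0 : n ≠ 0 := by
    obtain ⟨k, rfl⟩ := hn
    positivity
  have hG := integrable_dampedRoot hn0 (hconv a (by simp))
  set v : ℝ → ℂ := fun t => ∑ s ∈ S, residue (fun y => n * F y * Complex.exp (y * t)) s with hv
  have hunif : TendstoLocallyUniformlyOn (fun (R t : ℝ) =>
      verticalSegmentIntegral (fun y => n * F y * Complex.exp (y * t)) a R) v atTop (Ioi 0) :=
    tendstoLocallyUniformlyOn_verticalSegmentIntegral (F := fun y => n * F y) hS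
      (fun y hy => (hF y hy).differentiableAt.const_mul _)
      (by simpa using hlim.const_mul (n : ℂ))
  have hfun : ∀ x : ℝ, inversionIntegrand n F x =
      fun y => n * F y * Complex.exp (y * (x ^ n : ℝ)) := by
    intro x
    ext y
    simp [inversionIntegrand]
  have hres : ∀ x : ℝ, 0 < x → HasVerticalLineIntegral (inversionIntegrand n F x) a (v (x ^ n)) :=
    fun x hx => by
      rw [hfun]
      exact hunif.tendsto_at (pow_pos hx n)
  have hvx : ∀ x : ℝ, v (x ^ n) = ∑ s ∈ S, residue (inversionIntegrand n F x) s := fun x => by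
    rw [hfun]
  have hunifG : TendstoLocallyUniformlyOn (fourierPartialInv (dampedRoot n f a))
      (fun u => Complex.exp (-(a * u)) * v u) atTop (Ioi 0) := by
    rw [tendstoLocallyUniformlyOn_iff_forall_isCompact isOpen_Ioi] at hunif ⊢
    intro K hK hKc
    have hexp : Continuous fun u : ℝ => Complex.exp (-(a * u)) := by fun_prop
    obtain ⟨B, hB⟩ := hKc.exists_bound_of_continuousOn hexp.continuousOn
    rw [Metric.tendstoUniformlyOn_iff]
    intro ε hε
    have hlim2 : Tendsto (fun R : ℝ => 2 * Real.pi * R) atTop atTop :=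
      tendsto_id.const_mul_atTop (by positivity)
    filter_upwards [hlim2.eventually (Metric.tendstoUniformlyOn_iff.1 (hunif K hK hKc)
      (ε / (|B| + 1)) (by positivity))] with R hR u hu
    have h1 := hR u hu
    rw [dist_eq_norm] at h1 ⊢
    rw [fourierPartialInv_dampedRoot hn0 hFf, ← mul_sub, norm_mul]
    have h2 : ‖Complex.exp (-(a * u))‖ < |B| + 1 :=
      (hB u hu).trans_lt (by linarith [le_abs_self B])
    calc _ < (|B| + 1) * (ε / (|B| + 1)) :=
          mul_lt_mul_of_nonneg h2 h1 (norm_nonneg _) (norm_nonneg _)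
      _ = ε := by field_simp
  have hexp1 : ∀ u : ℝ, Complex.exp (a * u) * Complex.exp (-(a * u)) = 1 := fun u => by
    rw [← Complex.exp_add, add_neg_cancel, Complex.exp_zero]
  have hvc : ContinuousOn v (Ioi 0) := by
    have h1 := hunifG.continuousOn (Frequently.of_forall fun R =>
      (continuous_fourierPartialInv hG R).continuousOn)
    have h2 : Continuous fun u : ℝ => Complex.exp (a * u) := by fun_prop
    refine (h2.continuousOn.mul h1).congr fun u _ => ?_
    rw [Pi.mul_apply, ← mul_assoc, hexp1, one_mul]
  have hae : ∀ᵐ u : ℝ, 0 < u → f (u ^ (1 / (n : ℝ))) = v u := by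
    filter_upwards [ae_eq_of_tendstoLocallyUniformlyOn_fourierPartialInv hG isOpen_Ioi hunifG]
      with u hu hu0
    have h1 := hu hu0
    rw [dampedRoot, indicator_of_mem (mem_Ioi.2 hu0)] at h1
    exact mul_left_cancel₀ (Complex.exp_ne_zero _) h1
  have haex : ∀ᵐ x : ℝ, x ∈ Ioi (0 : ℝ) → f x = v (x ^ n) := by
    filter_upwards [ae_comp_pow_of_ae hn0 hae] with x hx hx0
    rw [← hx hx0, rpow_pow_one_div hn0 (le_of_lt hx0)]
  refine ⟨fun x hx => hvx x ▸ hres x hx, ?_, fun x hx hfx => ?_⟩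
  · filter_upwards [haex] with x hx hx0
    have h1 := hx hx0
    exact ⟨h1 ▸ hres x hx0, h1.trans (hvx x)⟩
  · have h1 : f x = v (x ^ n) := by
      refine eq_of_ae_eq_of_continuousAt isOpen_Ioi haex hx hfx ?_
      exact ContinuousAt.comp (g := v) (hvc.continuousAt (Ioi_mem_nhds (pow_pos hx n)))
        (continuous_pow n).continuousAt
    exact ⟨h1 ▸ hres x hx, h1.trans (hvx x)⟩
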